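/- **Setting.** An instance of Pandora's problem with non-obligatory inspection (PNOI) consists of $n$ boxes; box $i$ has a cost $c_i\ge 0$ and an initially hidden value $v_i\ge 0$ with a known law $F_i$ of finite mean, and $v_1,\dots,v_n$ are independent. At each step a policy may, adaptively and possibly at random, open a sealed box $i$, paying $c_i$ and observing $v_i$; or take a sealed box $i$ without inspection and quit, receiving $v_i$; or quit and receive the highest value observed so far ($0$ if no box has been opened). Its payoff is the value received minus the costs paid. A policy is optimal if it maximizes the expected payoff among all policies, including randomized ones. The index of box $i$ is the solution $\tau_i$ of $\mathbb E[\max\{v_i-\tau_i,0\}]=c_i$ (unique if $c_i>0$; if $c_i=0$, any solution, or $\tau_i=+\infty$, may be used). The index-based policy proceeds as follows: if the largest positive number among the indices of the sealed boxes and the values observed so far is an index, it opens that box; otherwise it quits with the highest value observed so far. Ties are broken arbitrarily. **Theorem.** For every PNOI instance there are a subset $T^*$ of the boxes, an ordering $\sigma$ of $T^*$, and a real threshold $V_i$ for each box $i\in T^*$ except the last one in $\sigma$, such that the following policy is optimal. If $T^*=\emptyset$, it is the index-based policy. Otherwise it opens the boxes of $T^*$ in the order $\sigma$ until either some opened box $i$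 shows a value $v_i\ge V_i$, or only one box of $T^*$ remains sealed. In the first case it switches to the index-based policy on all remaining boxes, with the highest value observed so far as a free outside option. In the second case (no threshold having been met) it takes the remaining box of $T^*$ without inspection. -/

import Mathlib

open MeasureTheory

universe u

/-- An instance of Pandora's box with non-obligatory inspection: `n` boxes, box `i` having a search
cost `cost i ≥ 0` and a nonnegative value with law `dist i` and finite mean. The values of different
boxes are independent: the vector of values has law `Measure.pi dist`. -/
structure PNOI (n : ℕ) where
  cost : Fin n → ℝ
  cost_nonneg : ∀ i, 0 ≤ cost i
  dist : Fin n → Measure ℝ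
  isProb : ∀ i, IsProbabilityMeasure (dist i)
  nonneg : ∀ i, ∀ᵐ x ∂(dist i), 0 ≤ x
  integrable : ∀ i, Integrable (fun x : ℝ => x) (dist i)

namespace Pandora

/-- The actions: open a sealed box, take a sealed box without inspection (and quit), or take the
highest value revealed so far (and quit). -/
inductive Action (n : ℕ) where
  | openBox (i : Fin n)
  | takeSealed (i : Fin n)
  | quit

instance (n : ℕ) : MeasurableSpace (Action n) := ⊤

/-- The highest value among the opened boxes `h`, given the values `v`; it is `0` if no box has been
opened (quitting right away is worth `0`). -/
noncomputable def best {n : ℕ} (h : List (Fin n)) (v : Fin n → ℝ) : ℝ :=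
  h.foldr (fun i m => max (v i) m) 0

/-- A deterministic (adaptive) policy. `act h v` is the action taken when the boxes opened so far are
those of the list `h`, the most recently opened box first, and the vector of values is `v`.
The action may only depend on the values of the opened boxes, and only sealed boxes may be opened or
taken without inspection. -/
structure Policy (n : ℕ) where
  act : List (Fin n) → (Fin n → ℝ) → Action n
  measurable_act : ∀ h, Measurable (act h)
  nonanticipating : ∀ h v w, (∀ i ∈ h, v i = w i) → act h v = act h w
  open_sealed : ∀ h v i, act h v = Action.openBox i → i ∉ h
  take_sealed : ∀ h v i, act h v = Action.takeSealed i → i ∉ h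

/-- The payoff (value taken minus the costs paid) collected from the history `h` on, when at most
`k` more boxes can be opened. -/
noncomputable def Policy.run {n : ℕ} (A : Policy n) (c v : Fin n → ℝ) : ℕ → List (Fin n) → ℝ
  | 0, h => best h v
  | k + 1, h =>
    match A.act h v with
    | Action.openBox i => A.run c v k (i :: h) - c i
    | Action.takeSealed i => v i
    | Action.quit => best h v

/-- The payoff of the policy `A` when the values are `v`. (After `n` openings no box is sealed, so
the only legal action is to quit.) -/
noncomputable def Policy.payoff {n : ℕ} (A : Policy n) (B : PNOI n) (v : Fin n → ℝ) : ℝ :=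
  A.run B.cost v n []

/-- The expected payoff of a deterministic policy. -/
noncomputable def Policy.expPayoff {n : ℕ} (A : Policy n) (B : PNOI n) : ℝ :=
  ∫ v, A.payoff B v ∂(Measure.pi B.dist)

/-- A randomized policy whose random seed takes values in `Ω`: for each seed a deterministic policy,
the actions being jointly measurable in the seed and the values. -/
structure RandPolicy (n : ℕ) (Ω : Type u) [MeasurableSpace Ω] where
  policy : Ω → Policy n
  measurable_act : ∀ h, Measurable (fun p : Ω × (Fin n → ℝ) => (policy p.1).act h p.2)

/-- The expected payoff of a randomized policy whose seed has law `μ` and is independent of the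
values. -/
noncomputable def RandPolicy.expPayoff {n : ℕ} {Ω : Type u} [MeasurableSpace Ω]
    (R : RandPolicy n Ω) (μ : Measure Ω) (B : PNOI n) : ℝ :=
  ∫ p, (R.policy p.1).payoff B p.2 ∂(μ.prod (Measure.pi B.dist))

/-- `A` is optimal: its expected payoff is maximal among all policies, randomized ones included. -/
def Policy.IsOptimal {n : ℕ} (A : Policy n) (B : PNOI n) : Prop :=
  ∀ (Ω : Type u) [MeasurableSpace Ω] (μ : Measure Ω) [IsProbabilityMeasure μ]
    (R : RandPolicy n Ω), R.expPayoff μ B ≤ A.expPayoff B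

/-- `t` is an index of box `i`, i.e. a solution of `E (vᵢ - t)₊ = cᵢ`. If `cᵢ > 0`, the solution is a
unique real number. If `cᵢ = 0`, the solutions are the upper bounds of the value of the box,
and `t = ∞` counts as one. -/
def IsIndex {n : ℕ} (B : PNOI n) (i : Fin n) (t : EReal) : Prop :=
  (∃ r : ℝ, t = (r : EReal) ∧ ∫ x, max (x - r) 0 ∂(B.dist i) = B.cost i) ∨
    (t = ⊤ ∧ B.cost i = 0)

/-- `a` is an action of the index-based policy with indices `τ`, after the boxes `h` were opened: if
the largest positive number among the indices of the sealed boxes and the values revealed is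
an index, open that box, and otherwise take the highest value revealed. Ties may be broken either
way. The highest value seen acts as a free outside option. -/
def IsIndexAction {n : ℕ} (τ : Fin n → EReal) (h : List (Fin n)) (v : Fin n → ℝ) :
    Action n → Prop
  | Action.openBox i =>
      i ∉ h ∧ 0 < τ i ∧ (best h v : EReal) ≤ τ i ∧ ∀ j, j ∉ h → τ j ≤ τ i
  | Action.takeSealed _ => False
  | Action.quit => ∀ j, j ∉ h → τ j ≤ (best h v : EReal)

/-- The policy has switched to the index-based policy: either the list `σ` is empty,
or some opened box of `σ`, other than its last one, has shown a value at least its threshold. -/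
def Switched {n : ℕ} (σ : List (Fin n)) (V : Fin n → ℝ) (h : List (Fin n)) (v : Fin n → ℝ) : Prop :=
  σ = [] ∨ ∃ i ∈ h, i ∈ σ.dropLast ∧ V i ≤ v i

/-- `a` is the action that is prescribed before the switch: if only one box of `σ` is sealed, take it
without inspection; if several are, open the first one of them. (The case where none is sealed does
not occur before the switch.) -/
def IsListAction {n : ℕ} (σ h : List (Fin n)) (a : Action n) : Prop :=
  match σ.filter (fun i => i ∉ h) with
  | [] => True
  | [i] => a = Action.takeSealed i
  | i :: _ :: _ => a = Action.openBox i

/-- `A` is the policy described by the ordered list `σ` of boxes and the thresholds `V` (up to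
the breaking of ties in the index-based policy with indices `τ`). -/
def Policy.DescribedBy {n : ℕ} (A : Policy n) (τ : Fin n → EReal) (σ : List (Fin n))
    (V : Fin n → ℝ) : Prop :=
  ∀ h v,
    (Switched σ V h v → IsIndexAction τ h v (A.act h v)) ∧
    (¬ Switched σ V h v → IsListAction σ h (A.act h v))

/-- Every box has an index. -/
theorem exists_isIndex {n : ℕ} (B : PNOI n) (i : Fin n) : ∃ t, IsIndex B i t := by
  have hp := B.isProb i
  rcases (B.cost_nonneg i).eq_or_lt with hc | hc
  · exact ⟨⊤, Or.inr ⟨rfl, hc.symm⟩⟩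
  have hint : ∀ r : ℝ, Integrable (fun x : ℝ => max (x - r) 0) (B.dist i) := fun r =>
    ((B.integrable i).sub (integrable_const r)).pos_part
  have hbound : ∀ r : ℝ, 0 ≤ r → ∀ᵐ x ∂(B.dist i), ‖max (x - r) 0‖ ≤ x := by
    intro r hr
    filter_upwards [B.nonneg i] with x hx
    rw [Real.norm_of_nonneg (le_max_right _ _)]
    exact max_le (by linarith) hx
  have hlip : LipschitzWith 1 (fun r : ℝ => ∫ x, max (x - r) 0 ∂(B.dist i)) := by
    refine LipschitzWith.of_dist_le_mul fun r s => ?_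
    rw [Real.dist_eq, ← integral_sub (hint r) (hint s), ← Real.norm_eq_abs]
    have h := norm_integral_le_of_norm_le_const (μ := B.dist i) (C := dist r s)
      (f := fun x => max (x - r) 0 - max (x - s) 0) (Filter.Eventually.of_forall fun x => by
        have := abs_max_sub_max_le_abs (x - r) (x - s) 0
        rw [Real.norm_eq_abs, Real.dist_eq]
        calc _ ≤ _ := this
          _ = |r - s| := by rw [abs_sub_comm r s]; congr 1; ring)
    simpa using h
  have hlim : Filter.Tendsto (fun r : ℝ => ∫ x, max (x - r) 0 ∂(B.dist i)) Filter.atTop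
      (nhds 0) := by
    have h := tendsto_integral_filter_of_dominated_convergence (μ := B.dist i)
      (l := (Filter.atTop : Filter ℝ)) (F := fun r x => max (x - r) 0) (f := fun _ => (0 : ℝ))
      (fun x => x)
      (Filter.Eventually.of_forall fun r => (hint r).aestronglyMeasurable)
      ((Filter.eventually_ge_atTop 0).mono hbound) (B.integrable i)
      (Filter.Eventually.of_forall fun x => by
        refine tendsto_const_nhds.congr' ?_
        filter_upwards [Filter.eventually_ge_atTop x] with r hr
        rw [max_eq_right (by linarith)])
    simpa using h
  obtain ⟨R, hR⟩ := (hlim.eventually (gt_mem_nhds hc)).exists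
  have hlow : B.cost i ≤ ∫ x, max (x - (-B.cost i)) 0 ∂(B.dist i) := by
    have h := integral_mono_ae (integrable_const (B.cost i)) (hint (-B.cost i))
      (by filter_upwards [B.nonneg i] with x hx; exact le_max_of_le_left (by linarith))
    simpa using h
  obtain ⟨r, hr⟩ := mem_range_of_exists_le_of_exists_ge hlip.continuous ⟨R, hR.le⟩ ⟨_, hlow⟩
  exact ⟨r, Or.inl ⟨r, rfl, hr⟩⟩

end Pandora

/-!
The proof is a dynamic programming argument. A state consists of the set `S` of sealed boxes and the
best value `y ≥ 0` seen so far. Let `indexValue S y = E max (y, max_{i ∈ S} min (vᵢ, τᵢ))`; this is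
Weitzman's formula for the value of the index-based policy from `(S, y)`. For every `i ∈ S`, opening
`i` first and then following the index-based policy is worth at most `indexValue S y`, with equality
if the index policy opens `i` (`indexValue_ge_open`, `indexValue_eq_open`).

Let `startValue S` be the optimal value from `(S, 0)`, defined by recursion on the number of sealed
boxes. The observation that makes the structure theorem work is that the optimal value from `(S, y)`
is `stateValue S y = max (indexValue S y) (startValue S)`: the outside option `y` matters only if
the index-based policy is used. To see that this function dominates the value of opening
`i` (`stateValue_ge_open`), compare `indexValue (S \ i) y` with `startValue (S \ i)`. If the former
is larger, then the index policy is in force after `i` is opened, whatever its value; if the latter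
is larger, then `y` is irrelevant after `i` is opened, and the value is at most the one from `y = 0`.
By induction, no policy does better than `stateValue` (`contValue_le`).

If `startValue S = indexValue S 0` for the set `S` of all boxes, the index-based policy is optimal.
Otherwise an optimal first move at `y = 0` is either to take a box without inspection, or to open
some box `i`; in the latter case `indexValue (S \ i) y < startValue (S \ i)` for every `y` with
`indexValue S y < startValue S` (`indexValue_lt_startValue_erase`). Hence the choice can be
repeated for `S \ i`, independently of the value of `i`, as long as `vᵢ` is below the least `V`
with `startValue (S \ i) ≤ indexValue (S \ i) V`, which serves as the threshold of `i`. This gives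
the list and its thresholds (`CommitPlan`, `exists_commitPlan`), and an induction along the list
shows that the policy they describe attains the optimal value (`contValue_ge_startValue`).
-/

namespace Pandora

open Finset

variable {n : ℕ}

instance (B : PNOI n) (i : Fin n) : IsProbabilityMeasure (B.dist i) := B.isProb i

/-- The law of the vector of values. -/
noncomputable abbrev law (B : PNOI n) : Measure (Fin n → ℝ) := Measure.pi B.dist

/-! ### Resampling one coordinate of a product measure -/

/-- Replacing the `i`-th value by an independent copy does not change the law of the values. -/
theorem measurePreserving_update (B : PNOI n) (i : Fin n) :
    MeasurePreserving (fun p : ℝ × (Fin n → ℝ) => Function.update p.2 i p.1)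
      ((B.dist i).prod (law B)) (law B) := by
  have hm : Measurable (fun p : ℝ × (Fin n → ℝ) => Function.update p.2 i p.1) := by
    refine measurable_pi_lambda _ fun j => ?_
    by_cases hj : j = i
    · subst hj
      simpa using measurable_fst
    · simpa only [Function.update_of_ne hj] using! (measurable_pi_apply j).comp measurable_snd
  refine ⟨hm, (Measure.pi_eq fun s hs => ?_).symm⟩
  rw [Measure.map_apply hm (MeasurableSet.univ_pi hs)]
  have hpre : (fun p : ℝ × (Fin n → ℝ) => Function.update p.2 i p.1) ⁻¹' (Set.univ.pi s)
      = s i ×ˢ (Set.univ.pi (Function.update s i Set.univ)) := by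
    ext p
    simp only [Set.mem_preimage, Set.mem_pi, Set.mem_univ, forall_const, Set.mem_prod]
    constructor
    · refine fun h => ⟨by simpa using h i, fun j => ?_⟩
      by_cases hj : j = i
      · subst hj; simp
      · simpa [Function.update_of_ne hj] using h j
    · rintro ⟨h1, h2⟩ j
      by_cases hj : j = i
      · subst hj; simpa using h1
      · simpa [Function.update_of_ne hj] using h2 j
  rw [hpre, Measure.prod_prod, Measure.pi_pi, ← Finset.mul_prod_erase univ _ (mem_univ i),
    ← Finset.mul_prod_erase univ (fun j => B.dist j (s j)) (mem_univ i)]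
  simp only [Function.update_self, measure_univ, one_mul]
  congr 1
  refine Finset.prod_congr rfl fun j hj => ?_
  rw [Function.update_of_ne (Finset.ne_of_mem_erase hj)]

theorem integrable_update {B : PNOI n} {f : (Fin n → ℝ) → ℝ} (hf : Integrable f (law B))
    (i : Fin n) :
    Integrable (fun p : ℝ × (Fin n → ℝ) => f (Function.update p.2 i p.1))
      ((B.dist i).prod (law B)) :=
  (measurePreserving_update B i).integrable_comp_of_integrable hf

theorem integral_eq_integral_update {B : PNOI n} {f : (Fin n → ℝ) → ℝ}
    (hf : Integrable f (law B)) (i : Fin n) :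
    ∫ w, f w ∂(law B) = ∫ p, f (Function.update p.2 i p.1) ∂((B.dist i).prod (law B)) := by
  have h := measurePreserving_update B i
  conv_lhs => rw [← h.map_eq]
  rw [integral_map h.measurable.aemeasurable]
  rw [h.map_eq]
  exact hf.aestronglyMeasurable

theorem integral_resample {B : PNOI n} {f : (Fin n → ℝ) → ℝ} (hf : Integrable f (law B))
    (i : Fin n) :
    ∫ w, f w ∂(law B) = ∫ x, ∫ w, f (Function.update w i x) ∂(law B) ∂(B.dist i) := by
  rw [integral_eq_integral_update hf i, integral_prod _ (integrable_update hf i)]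

theorem integral_resample_symm {B : PNOI n} {f : (Fin n → ℝ) → ℝ} (hf : Integrable f (law B))
    (i : Fin n) :
    ∫ w, f w ∂(law B) = ∫ w, ∫ x, f (Function.update w i x) ∂(B.dist i) ∂(law B) := by
  rw [integral_eq_integral_update hf i, integral_prod_symm _ (integrable_update hf i)]

theorem integrable_comp_max_of_lipschitz {μ : Measure ℝ} [IsFiniteMeasure μ] {f : ℝ → ℝ}
    (hf : LipschitzWith 1 f) (hμ : Integrable (fun x : ℝ => x) μ) (y : ℝ) :
    Integrable (fun x => f (max x y)) μ := by
  have hmax : Integrable (fun x : ℝ => max x y) μ := hμ.sup (integrable_const y)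
  refine Integrable.mono' ((integrable_const |f 0|).add hmax.abs)
    (hf.continuous.comp (continuous_id.max continuous_const)).aestronglyMeasurable
    (Filter.Eventually.of_forall fun x => ?_)
  have h := hf.dist_le_mul (max x y) 0
  simp only [Real.dist_eq, NNReal.coe_one, one_mul, sub_zero] at h
  have h2 := abs_sub_abs_le_abs_sub (f (max x y)) (f 0)
  simp only [Real.norm_eq_abs, Pi.add_apply]
  linarith

/-! ### Capped values -/

/-- The value `x` capped at the index `t`, i.e. `min x t`. -/
noncomputable def cap (t : EReal) (x : ℝ) : ℝ := (min (x : EReal) t).toReal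

theorem cap_coe (r x : ℝ) : cap (r : EReal) x = min x r := by
  rw [cap, ← EReal.coe_strictMono.monotone.map_min, EReal.toReal_coe]

theorem cap_top (x : ℝ) : cap ⊤ x = x := by simp [cap]

theorem IsIndex.cap_le {B : PNOI n} {i : Fin n} {t : EReal} (ht : IsIndex B i t) (x : ℝ) :
    (cap t x : EReal) ≤ t := by
  rcases ht with ⟨r, rfl, -⟩ | ⟨rfl, -⟩
  · rw [cap_coe]; exact_mod_cast min_le_right x r
  · exact le_top

theorem IsIndex.integrable_cap {B : PNOI n} {i : Fin n} {t : EReal} (ht : IsIndex B i t) :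
    Integrable (cap t) (B.dist i) := by
  rcases ht with ⟨r, rfl, -⟩ | ⟨rfl, -⟩
  · have : cap (r : EReal) = fun x => min x r := funext fun x => cap_coe r x
    rw [this]
    exact (B.integrable i).inf (integrable_const r)
  · have : cap ⊤ = fun x => x := funext cap_top
    rw [this]
    exact B.integrable i

theorem integrable_max_const {B : PNOI n} {i : Fin n} {f : ℝ → ℝ}
    (hf : Integrable f (B.dist i)) (z : ℝ) : Integrable (fun x => max (f x) z) (B.dist i) :=
  hf.sup (integrable_const z)

/-- With outside option `z`, inspecting a box at its cost is worth at most as much as receiving its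
capped value for free. -/
theorem IsIndex.integral_max_le {B : PNOI n} {i : Fin n} {t : EReal} (ht : IsIndex B i t)
    (z : ℝ) :
    ∫ x, max x z ∂(B.dist i) - B.cost i ≤ ∫ x, max (cap t x) z ∂(B.dist i) := by
  have hcap := integrable_max_const ht.integrable_cap z
  rcases ht with ⟨r, rfl, hr⟩ | ⟨rfl, hc⟩
  · have hpos : Integrable (fun x : ℝ => max (x - r) 0) (B.dist i) :=
      integrable_max_const ((B.integrable i).sub (integrable_const r)) 0
    rw [← hr, sub_le_iff_le_add, ← integral_add hcap hpos]
    refine integral_mono (integrable_max_const (B.integrable i) z) (hcap.add hpos) fun x => ?_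
    simp only [cap_coe]
    rcases le_total x r with h | h <;> rcases le_total x z with h' | h' <;>
      rcases le_total r z with h'' | h'' <;>
      simp [h, h', h''] <;> linarith
  · simp [cap_top, hc]

/-- Equality holds if the outside option does not exceed the index. -/
theorem IsIndex.integral_max_eq {B : PNOI n} {i : Fin n} {t : EReal} (ht : IsIndex B i t)
    {z : ℝ} (hz : (z : EReal) ≤ t) :
    ∫ x, max (cap t x) z ∂(B.dist i) = ∫ x, max x z ∂(B.dist i) - B.cost i := by
  have hcap := integrable_max_const ht.integrable_cap z
  rcases ht with ⟨r, rfl, hr⟩ | ⟨rfl, hc⟩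
  · have hpos : Integrable (fun x : ℝ => max (x - r) 0) (B.dist i) :=
      integrable_max_const ((B.integrable i).sub (integrable_const r)) 0
    have hz' : z ≤ r := by exact_mod_cast hz
    rw [← hr, eq_sub_iff_add_eq, ← integral_add hcap hpos]
    refine integral_congr_ae (Filter.Eventually.of_forall fun x => ?_)
    simp only [cap_coe]
    rcases le_total x r with h | h
    · simp [h]
    · simp [h, hz', hz'.trans h]
  · simp [cap_top, hc]

/-! ### The value of the index-based policy -/

/-- The largest of `y` and the capped values of the boxes in `S`. -/
noncomputable def cappedMax (τ : Fin n → EReal) (S : Finset (Fin n)) (y : ℝ) (v : Fin n → ℝ) : ℝ :=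
  S.fold max y fun i => cap (τ i) (v i)

theorem le_cappedMax (τ : Fin n → EReal) (S : Finset (Fin n)) (y : ℝ) (v : Fin n → ℝ) :
    y ≤ cappedMax τ S y v :=
  (le_fold_max _).2 (Or.inl le_rfl)

theorem cappedMax_le_add (τ : Fin n → EReal) (S : Finset (Fin n)) {y y' d : ℝ} (v : Fin n → ℝ)
    (hd : 0 ≤ d) (h : y ≤ y' + d) : cappedMax τ S y v ≤ cappedMax τ S y' v + d := by
  refine (fold_max_le _).2 ⟨h.trans (by gcongr; exact le_cappedMax τ S y' v), fun i hi => ?_⟩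
  have : cap (τ i) (v i) ≤ cappedMax τ S y' v := (le_fold_max _).2 (Or.inr ⟨i, hi, le_rfl⟩)
  linarith

theorem cappedMax_max (τ : Fin n → EReal) (S : Finset (Fin n)) (x y : ℝ) (v : Fin n → ℝ) :
    cappedMax τ S (max x y) v = max x (cappedMax τ S y v) := by
  induction S using Finset.induction_on with
  | empty => simp [cappedMax]
  | insert i S hi ih =>
    simp only [cappedMax, fold_insert hi] at ih ⊢
    rw [ih, max_left_comm]

theorem cappedMax_update (τ : Fin n → EReal) {S : Finset (Fin n)} {i : Fin n} (hi : i ∉ S)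
    (y x : ℝ) (v : Fin n → ℝ) :
    cappedMax τ S y (Function.update v i x) = cappedMax τ S y v := by
  refine fold_congr fun j hj => ?_
  rw [Function.update_of_ne (ne_of_mem_of_not_mem hj hi)]

theorem cappedMax_eq_erase (τ : Fin n → EReal) {S : Finset (Fin n)} {i : Fin n} (hi : i ∈ S)
    (y : ℝ) (v : Fin n → ℝ) :
    cappedMax τ S y v = max (cap (τ i) (v i)) (cappedMax τ (S.erase i) y v) := by
  conv_lhs => rw [← insert_erase hi]
  exact fold_insert (notMem_erase i S)

theorem coe_cappedMax_le {B : PNOI n} {τ : Fin n → EReal} (hτ : ∀ i, IsIndex B i (τ i))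
    {S : Finset (Fin n)} {y : ℝ} {t : EReal} (hy : (y : EReal) ≤ t) (h : ∀ j ∈ S, τ j ≤ t)
    (v : Fin n → ℝ) : (cappedMax τ S y v : EReal) ≤ t := by
  induction S using Finset.induction_on with
  | empty => simpa [cappedMax] using hy
  | insert i S hi ih =>
    have h1 := ih fun j hj => h j (mem_insert_of_mem hj)
    have h2 := ((hτ i).cap_le (v i)).trans (h i (mem_insert_self i S))
    simp only [cappedMax, fold_insert hi] at h1 ⊢
    rw [EReal.coe_strictMono.monotone.map_max]
    exact max_le h2 h1

theorem integrable_cappedMax {B : PNOI n} {τ : Fin n → EReal} (hτ : ∀ i, IsIndex B i (τ i))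
    (S : Finset (Fin n)) (y : ℝ) : Integrable (cappedMax τ S y) (law B) := by
  induction S using Finset.induction_on with
  | empty => simpa [cappedMax] using! integrable_const y
  | insert i S hi ih =>
    have : cappedMax τ (insert i S) y = fun v => max (cap (τ i) (v i)) (cappedMax τ S y v) :=
      funext fun v => fold_insert hi
    rw [this]
    exact (integrable_comp_eval (hτ i).integrable_cap).sup ih

/-- The value of the index-based policy when the boxes of `S` are sealed and the outside option is
`y`, by Weitzman's formula. -/
noncomputable def indexValue (B : PNOI n) (τ : Fin n → EReal) (S : Finset (Fin n)) (y : ℝ) : ℝ :=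
  ∫ v, cappedMax τ S y v ∂(law B)

theorem indexValue_empty (B : PNOI n) (τ : Fin n → EReal) (y : ℝ) : indexValue B τ ∅ y = y := by
  simp [indexValue, cappedMax]

section IndexValue

variable {B : PNOI n} {τ : Fin n → EReal}

theorem indexValue_le_add (hτ : ∀ i, IsIndex B i (τ i)) (S : Finset (Fin n)) {y y' d : ℝ}
    (hd : 0 ≤ d) (h : y ≤ y' + d) : indexValue B τ S y ≤ indexValue B τ S y' + d := by
  have hint := integrable_cappedMax hτ S y'
  have : indexValue B τ S y' + d = ∫ v, (cappedMax τ S y' v + d) ∂(law B) := by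
    rw [integral_add hint (integrable_const d)]
    simp [indexValue]
  rw [this]
  exact integral_mono (integrable_cappedMax hτ S y) (hint.add (integrable_const d))
    fun v => cappedMax_le_add τ S v hd h

theorem indexValue_mono (hτ : ∀ i, IsIndex B i (τ i)) (S : Finset (Fin n)) :
    Monotone (indexValue B τ S) := fun y y' h => by
  simpa using indexValue_le_add hτ S (y := y) (y' := y') le_rfl (by simpa using h)

theorem indexValue_lipschitz (hτ : ∀ i, IsIndex B i (τ i)) (S : Finset (Fin n)) :
    LipschitzWith 1 (indexValue B τ S) :=
  LipschitzWith.of_le_add fun y y' => indexValue_le_add hτ S dist_nonneg <| by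
    rw [Real.dist_eq]
    linarith [le_abs_self (y - y')]

theorem le_indexValue (hτ : ∀ i, IsIndex B i (τ i)) (S : Finset (Fin n)) (y : ℝ) :
    y ≤ indexValue B τ S y := by
  have h := integral_mono (integrable_const y) (integrable_cappedMax hτ S y)
    fun v => le_cappedMax τ S y v
  simpa [indexValue] using h

theorem indexValue_eq_of_le (hτ : ∀ i, IsIndex B i (τ i)) {S : Finset (Fin n)} {y : ℝ}
    (h : ∀ j ∈ S, τ j ≤ (y : EReal)) : indexValue B τ S y = y := by
  have : ∀ v, cappedMax τ S y v = y := fun v =>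
    le_antisymm (by exact_mod_cast coe_cappedMax_le hτ le_rfl h v) (le_cappedMax τ S y v)
  simp [indexValue, this]

theorem indexValue_eq_resample (hτ : ∀ i, IsIndex B i (τ i)) {S : Finset (Fin n)} {i : Fin n}
    (hi : i ∈ S) (y : ℝ) :
    Integrable (fun w => ∫ x, max (cap (τ i) x) (cappedMax τ (S.erase i) y w) ∂(B.dist i))
        (law B) ∧
      indexValue B τ S y
        = ∫ w, ∫ x, max (cap (τ i) x) (cappedMax τ (S.erase i) y w) ∂(B.dist i) ∂(law B) := by
  have hint := integrable_cappedMax hτ S y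
  have h : ∀ w x, cappedMax τ S y (Function.update w i x)
      = max (cap (τ i) x) (cappedMax τ (S.erase i) y w) := fun w x => by
    rw [cappedMax_eq_erase τ hi, cappedMax_update τ (notMem_erase i S), Function.update_self]
  refine ⟨?_, ?_⟩
  · simpa only [h] using (integrable_update hint i).integral_prod_right
  · rw [indexValue, integral_resample_symm hint i]
    simp only [h]

theorem integral_indexValue_eq_resample (hτ : ∀ i, IsIndex B i (τ i)) (S : Finset (Fin n))
    (i : Fin n) (y : ℝ) :
    Integrable (fun w => ∫ x, max x (cappedMax τ (S.erase i) y w) ∂(B.dist i)) (law B) ∧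
      ∫ x, indexValue B τ (S.erase i) (max x y) ∂(B.dist i)
        = ∫ w, ∫ x, max x (cappedMax τ (S.erase i) y w) ∂(B.dist i) ∂(law B) := by
  have hint : Integrable (fun w => max (w i) (cappedMax τ (S.erase i) y w)) (law B) :=
    (integrable_comp_eval (f := fun x => x) (B.integrable i)).sup
      (integrable_cappedMax hτ (S.erase i) y)
  have h : ∀ w x, max (Function.update w i x i)
      (cappedMax τ (S.erase i) y (Function.update w i x))
      = max x (cappedMax τ (S.erase i) y w) := fun w x => by
    rw [cappedMax_update τ (notMem_erase i S), Function.update_self]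
  refine ⟨?_, ?_⟩
  · simpa only [h] using (integrable_update hint i).integral_prod_right
  · have h1 := integral_resample hint i
    have h2 := integral_resample_symm hint i
    simp only [h] at h1 h2
    rw [← h2, h1]
    simp only [indexValue, cappedMax_max]

/-- Opening a box and then following the index-based policy does not beat the
index-based policy. -/
theorem indexValue_ge_open (hτ : ∀ i, IsIndex B i (τ i)) {S : Finset (Fin n)} {i : Fin n}
    (hi : i ∈ S) (y : ℝ) :
    ∫ x, indexValue B τ (S.erase i) (max x y) ∂(B.dist i) - B.cost i ≤ indexValue B τ S y := by
  obtain ⟨h1, h2⟩ := indexValue_eq_resample hτ hi y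
  obtain ⟨h3, h4⟩ := integral_indexValue_eq_resample hτ S i y
  have h5 := integral_mono (h3.sub (integrable_const (B.cost i))) h1
    fun w => (hτ i).integral_max_le (cappedMax τ (S.erase i) y w)
  rw [integral_sub' h3 (integrable_const _)] at h5
  rw [h2, h4]
  simpa using h5

/-- If `i` is the box that the index-based policy opens, opening it attains the value. -/
theorem indexValue_eq_open (hτ : ∀ i, IsIndex B i (τ i)) {S : Finset (Fin n)} {i : Fin n}
    (hi : i ∈ S) {y : ℝ} (hy : (y : EReal) ≤ τ i) (hmax : ∀ j ∈ S, τ j ≤ τ i) :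
    indexValue B τ S y
      = ∫ x, indexValue B τ (S.erase i) (max x y) ∂(B.dist i) - B.cost i := by
  obtain ⟨h1, h2⟩ := indexValue_eq_resample hτ hi y
  obtain ⟨h3, h4⟩ := integral_indexValue_eq_resample hτ S i y
  have h5 : ∀ w, ∫ x, max (cap (τ i) x) (cappedMax τ (S.erase i) y w) ∂(B.dist i)
      = ∫ x, max x (cappedMax τ (S.erase i) y w) ∂(B.dist i) - B.cost i := fun w =>
    (hτ i).integral_max_eq
      (coe_cappedMax_le hτ hy (fun j hj => hmax j (mem_of_mem_erase hj)) w)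
  rw [h2, h4]
  simp only [h5]
  rw [integral_sub h3 (integrable_const _)]
  simp

theorem integrable_indexValue_max (hτ : ∀ i, IsIndex B i (τ i)) (S : Finset (Fin n))
    (i : Fin n) (y : ℝ) : Integrable (fun x => indexValue B τ S (max x y)) (B.dist i) :=
  integrable_comp_max_of_lipschitz (indexValue_lipschitz hτ S) (B.integrable i) y

/-- The value of the index-based policy does not depend on the choice of the indices: by symmetry,
one inequality suffices. It makes the list and the thresholds work for all indices at once. -/
theorem indexValue_le_indexValue (hτ : ∀ i, IsIndex B i (τ i)) {τ' : Fin n → EReal}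
    (hτ' : ∀ i, IsIndex B i (τ' i)) (S : Finset (Fin n)) (y : ℝ) :
    indexValue B τ S y ≤ indexValue B τ' S y := by
  induction S using Finset.strongInduction generalizing y with
  | H S ih =>
    by_cases h : ∀ j ∈ S, τ j ≤ (y : EReal)
    · rw [indexValue_eq_of_le hτ h]
      exact le_indexValue hτ' S y
    · push Not at h
      obtain ⟨j, hj, hjy⟩ := h
      obtain ⟨i, hi, hmax⟩ := S.exists_max_image τ ⟨j, hj⟩
      rw [indexValue_eq_open hτ hi (hjy.le.trans (hmax j hj)) hmax]
      refine le_trans (sub_le_sub_right ?_ _) (indexValue_ge_open hτ' hi y)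
      exact integral_mono (integrable_indexValue_max hτ _ i y)
        (integrable_indexValue_max hτ' _ i y) fun x => ih _ (erase_ssubset hi) _

end IndexValue

/-! ### The optimal value -/

/-- The value of opening box `i` with outside option `0` when afterwards the continuation is worth
`max (indexValue (S.erase i) y) m`. -/
noncomputable def openValue (B : PNOI n) (τ : Fin n → EReal) (S : Finset (Fin n)) (i : Fin n)
    (m : ℝ) : ℝ :=
  ∫ x, max (indexValue B τ (S.erase i) (max x 0)) m ∂(B.dist i) - B.cost i

/-- The optimal value with sealed boxes `S` and outside option `0`, when at most `k` boxes
are opened before the index-based policy is used. -/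
noncomputable def startValueAux (B : PNOI n) (τ : Fin n → EReal) : ℕ → Finset (Fin n) → ℝ
  | 0, S => indexValue B τ S 0
  | k + 1, S => S.fold max (indexValue B τ S 0) fun i =>
      max (∫ x, x ∂(B.dist i)) (openValue B τ S i (startValueAux B τ k (S.erase i)))

/-- The optimal value with sealed boxes `S` and outside option `0`. -/
noncomputable def startValue (B : PNOI n) (τ : Fin n → EReal) (S : Finset (Fin n)) : ℝ :=
  startValueAux B τ S.card S

/-- The optimal value with sealed boxes `S` and outside option `y ≥ 0`. -/
noncomputable def stateValue (B : PNOI n) (τ : Fin n → EReal) (S : Finset (Fin n)) (y : ℝ) : ℝ :=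
  max (indexValue B τ S y) (startValue B τ S)

section StartValue

variable {B : PNOI n} {τ : Fin n → EReal} {S : Finset (Fin n)} {i : Fin n}

theorem startValue_eq_fold (B : PNOI n) (τ : Fin n → EReal) (S : Finset (Fin n)) :
    startValue B τ S = S.fold max (indexValue B τ S 0) fun i =>
      max (∫ x, x ∂(B.dist i)) (openValue B τ S i (startValue B τ (S.erase i))) := by
  rcases S.eq_empty_or_nonempty with rfl | hS
  · simp [startValue, startValueAux]
  · obtain ⟨k, hk⟩ := Nat.exists_eq_add_one_of_ne_zero hS.card_ne_zero
    rw [startValue, hk, startValueAux]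
    refine fold_congr fun i hi => ?_
    rw [startValue, card_erase_of_mem hi, hk, Nat.add_sub_cancel]

theorem indexValue_le_startValue (B : PNOI n) (τ : Fin n → EReal) (S : Finset (Fin n)) :
    indexValue B τ S 0 ≤ startValue B τ S := by
  rw [startValue_eq_fold]
  exact (le_fold_max _).2 (Or.inl le_rfl)

theorem mean_le_startValue (τ : Fin n → EReal) (hi : i ∈ S) :
    ∫ x, x ∂(B.dist i) ≤ startValue B τ S := by
  rw [startValue_eq_fold]
  exact (le_fold_max _).2 (Or.inr ⟨i, hi, le_max_left _ _⟩)

theorem openValue_le_startValue (hi : i ∈ S) :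
    openValue B τ S i (startValue B τ (S.erase i)) ≤ startValue B τ S := by
  conv_rhs => rw [startValue_eq_fold]
  exact (le_fold_max _).2 (Or.inr ⟨i, hi, le_max_right _ _⟩)

/-- An optimal first move with outside option `0`. -/
theorem exists_first_move (h : indexValue B τ S 0 < startValue B τ S) :
    ∃ i ∈ S, startValue B τ S ≤ ∫ x, x ∂(B.dist i) ∨
      startValue B τ S ≤ openValue B τ S i (startValue B τ (S.erase i)) := by
  have h1 := (startValue_eq_fold B τ S).le
  rcases (le_fold_max _).1 h1 with h2 | ⟨i, hi, h2⟩
  · exact absurd h2 h.not_ge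
  · exact ⟨i, hi, le_max_iff.1 h2⟩

theorem integrable_stateValue_max (hτ : ∀ i, IsIndex B i (τ i)) (S : Finset (Fin n))
    (i : Fin n) (y : ℝ) : Integrable (fun x => stateValue B τ S (max x y)) (B.dist i) :=
  integrable_max_const (integrable_indexValue_max hτ S i y) _

theorem le_stateValue (hτ : ∀ i, IsIndex B i (τ i)) (S : Finset (Fin n)) (y : ℝ) :
    y ≤ stateValue B τ S y :=
  (le_indexValue hτ S y).trans (le_max_left _ _)

/-- Opening a box does not beat `stateValue`. -/
theorem stateValue_ge_open (hτ : ∀ i, IsIndex B i (τ i)) (hi : i ∈ S) {y : ℝ} (hy : 0 ≤ y) :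
    ∫ x, stateValue B τ (S.erase i) (max x y) ∂(B.dist i) - B.cost i ≤ stateValue B τ S y := by
  have hmono := indexValue_mono hτ (S.erase i)
  rcases le_total (startValue B τ (S.erase i)) (indexValue B τ (S.erase i) y) with h | h
  · -- The index-based policy is in force after the opening, whatever the value `x` of the box.
    refine le_trans (le_of_eq ?_) ((indexValue_ge_open hτ hi y).trans (le_max_left _ _))
    congr 2
    funext x
    exact max_eq_left (h.trans (hmono (le_max_right x y)))
  · -- The outside option `y` is irrelevant after the opening.
    refine le_trans (sub_le_sub_right ?_ _)
      ((openValue_le_startValue (τ := τ) hi).trans (le_max_right _ _))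
    refine integral_mono (integrable_stateValue_max hτ _ i y)
      (integrable_stateValue_max hτ _ i 0) fun x => max_le ?_ (le_max_right _ _)
    rcases le_total x y with hxy | hxy
    · rw [max_eq_right hxy]
      exact h.trans (le_max_right _ _)
    · simp only [max_eq_left hxy, max_eq_left (hy.trans hxy)]
      exact le_max_left _ _

/-- If opening `i` is an optimal first move at outside option `0`, and the index-based policy is
suboptimal before `i` is opened, then it remains so if the value of `i` is low. -/
theorem indexValue_lt_startValue_erase (hτ : ∀ i, IsIndex B i (τ i)) (hi : i ∈ S)
    (hopen : startValue B τ S ≤ openValue B τ S i (startValue B τ (S.erase i)))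
    {y : ℝ} (hy : 0 ≤ y) (h : indexValue B τ S y < startValue B τ S) :
    indexValue B τ (S.erase i) y < startValue B τ (S.erase i) := by
  by_contra! hle
  have hmono := indexValue_mono hτ (S.erase i)
  refine (hopen.trans (le_trans (sub_le_sub_right ?_ _) (indexValue_ge_open hτ hi y))).not_gt h
  refine integral_mono (integrable_stateValue_max hτ _ i 0)
    (integrable_indexValue_max hτ _ i y) fun x => max_le (hmono ?_) (hle.trans (hmono ?_))
  · exact max_le_max le_rfl hy
  · exact le_max_right _ _

end StartValue

/-! ### Lists with thresholds -/

/-- `CommitPlan B τ V S ρ`: when the boxes of `S` are sealed, it is optimal at outside option `0` to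
go through the list `ρ`, the last box of which is taken without inspection. The
threshold `V i` separates the outside options for which the index-based policy is optimal after the
opening of `i` from the others. -/
inductive CommitPlan (B : PNOI n) (τ : Fin n → EReal) (V : Fin n → ℝ) :
    Finset (Fin n) → List (Fin n) → Prop
  | last {S : Finset (Fin n)} {i : Fin n} (mem : i ∈ S)
      (take : startValue B τ S ≤ ∫ x, x ∂(B.dist i)) : CommitPlan B τ V S [i]
  | cons {S : Finset (Fin n)} {i : Fin n} {ρ : List (Fin n)} (mem : i ∈ S)
      (opn : startValue B τ S ≤ openValue B τ S i (startValue B τ (S.erase i)))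
      (thr : ∀ y, V i ≤ y ↔ startValue B τ (S.erase i) ≤ indexValue B τ (S.erase i) y)
      (tail : CommitPlan B τ V (S.erase i) ρ) : CommitPlan B τ V S (i :: ρ)

section CommitPlan

variable {B : PNOI n} {τ : Fin n → EReal} {V : Fin n → ℝ} {S : Finset (Fin n)}
  {ρ : List (Fin n)}

theorem CommitPlan.ne_nil (h : CommitPlan B τ V S ρ) : ρ ≠ [] := by
  cases h <;> simp

theorem CommitPlan.mem_of_mem (h : CommitPlan B τ V S ρ) : ∀ j ∈ ρ, j ∈ S := by
  induction h with
  | last mem take => simpa using mem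
  | cons mem opn thr tail ih =>
    intro j hj
    rcases List.mem_cons.1 hj with rfl | hj
    · exact mem
    · exact mem_of_mem_erase (ih j hj)

theorem CommitPlan.nodup (h : CommitPlan B τ V S ρ) : ρ.Nodup := by
  induction h with
  | last mem take => simp
  | cons mem opn thr tail ih =>
    exact List.nodup_cons.2 ⟨fun hj => notMem_erase _ _ (tail.mem_of_mem _ hj), ih⟩

theorem CommitPlan.congr {V' : Fin n → ℝ} (h : CommitPlan B τ V S ρ)
    (hV : ∀ j ∈ ρ, V' j = V j) : CommitPlan B τ V' S ρ := by
  induction h with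
  | last mem take => exact .last mem take
  | cons mem opn thr tail ih =>
    refine .cons mem opn ?_ (ih fun j hj => hV j (List.mem_cons_of_mem _ hj))
    rw [hV _ List.mem_cons_self]
    exact thr

/-- The index-based policy is optimal for the outside options above some threshold. -/
theorem exists_threshold (hτ : ∀ i, IsIndex B i (τ i))
    (h : indexValue B τ S 0 < startValue B τ S) :
    ∃ V : ℝ, ∀ y, V ≤ y ↔ startValue B τ S ≤ indexValue B τ S y := by
  have hmono := indexValue_mono hτ S
  have hclosed : IsClosed {y | startValue B τ S ≤ indexValue B τ S y} :=
    isClosed_le continuous_const (indexValue_lipschitz hτ S).continuous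
  have hbdd : BddBelow {y | startValue B τ S ≤ indexValue B τ S y} :=
    ⟨0, fun y hy => le_of_not_gt fun hy0 => (hy.trans (hmono hy0.le)).not_gt h⟩
  -- The threshold is the least such outside option; the set contains `startValue B τ S`.
  have hmem := hclosed.csInf_mem ⟨startValue B τ S, le_indexValue hτ S _⟩ hbdd
  exact ⟨_, fun y => ⟨fun hy => le_trans hmem (hmono hy), fun hy => csInf_le hbdd hy⟩⟩

theorem exists_commitPlan (hτ : ∀ i, IsIndex B i (τ i)) (S : Finset (Fin n))
    (h : indexValue B τ S 0 < startValue B τ S) :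
    ∃ (V : Fin n → ℝ) (ρ : List (Fin n)), CommitPlan B τ V S ρ := by
  induction S using Finset.strongInduction with
  | H S ih =>
    obtain ⟨i, hi, htake | hopen⟩ := exists_first_move h
    · exact ⟨0, [i], .last hi htake⟩
    · have h' := indexValue_lt_startValue_erase hτ hi hopen le_rfl h
      obtain ⟨V, ρ, hρ⟩ := ih _ (erase_ssubset hi) h'
      obtain ⟨t, ht⟩ := exists_threshold hτ h'
      refine ⟨Function.update V i t, i :: ρ, .cons hi hopen (by simpa using ht)
        (hρ.congr fun j hj => Function.update_of_ne ?_ _ _)⟩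
      rintro rfl
      exact notMem_erase _ _ (hρ.mem_of_mem _ hj)

end CommitPlan

/-! ### The continuation value of a policy -/

/-- The values `v` on the opened boxes `h` and the values `w` on the sealed ones. -/
def merge (h : List (Fin n)) (v w : Fin n → ℝ) : Fin n → ℝ := fun j => if j ∈ h then v j else w j

/-- The set of the boxes that are sealed after those of `h` were opened. -/
def sealedBoxes (h : List (Fin n)) : Finset (Fin n) := h.toFinsetᶜ

theorem mem_sealedBoxes {h : List (Fin n)} {i : Fin n} : i ∈ sealedBoxes h ↔ i ∉ h := by
  simp [sealedBoxes]

theorem sealedBoxes_cons (i : Fin n) (h : List (Fin n)) :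
    sealedBoxes (i :: h) = (sealedBoxes h).erase i := by
  simp [sealedBoxes, compl_insert]

theorem merge_nil (v w : Fin n → ℝ) : merge [] v w = w := by
  funext j; simp [merge]

theorem merge_update {h : List (Fin n)} {i : Fin n} (hi : i ∉ h) (v w : Fin n → ℝ) (x : ℝ) :
    merge h v (Function.update w i x) = merge (i :: h) (Function.update v i x) w := by
  funext j
  by_cases hj : j = i
  · subst hj; simp [merge, hi]
  · simp [merge, hj]

theorem best_nonneg (h : List (Fin n)) (v : Fin n → ℝ) : 0 ≤ best h v := by
  induction h with
  | nil => exact le_rfl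
  | cons i h ih => exact le_max_of_le_right ih

theorem best_congr {h : List (Fin n)} {v w : Fin n → ℝ} (hvw : ∀ i ∈ h, v i = w i) :
    best h v = best h w := by
  induction h with
  | nil => rfl
  | cons i h ih =>
    have := ih fun j hj => hvw j (List.mem_cons_of_mem _ hj)
    simp only [best, List.foldr_cons] at this ⊢
    rw [this, hvw i List.mem_cons_self]

theorem best_cons_update {h : List (Fin n)} {i : Fin n} (hi : i ∉ h) (v : Fin n → ℝ) (x : ℝ) :
    best (i :: h) (Function.update v i x) = max x (best h v) := by
  have : best h (Function.update v i x) = best h v :=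
    best_congr fun j hj => Function.update_of_ne (ne_of_mem_of_not_mem hj hi) _ _
  rw [← this]
  simp [best]

theorem measurable_best (h : List (Fin n)) : Measurable (best h : (Fin n → ℝ) → ℝ) := by
  induction h with
  | nil => exact measurable_const
  | cons i h ih => exact (measurable_pi_apply i).max ih

theorem best_le_sum (h : List (Fin n)) (v : Fin n → ℝ) : best h v ≤ ∑ j, |v j| := by
  induction h with
  | nil => exact sum_nonneg fun j _ => abs_nonneg _
  | cons i h ih =>
    exact max_le ((le_abs_self _).trans
      (single_le_sum (f := fun j => |v j|) (fun j _ => abs_nonneg _) (mem_univ i))) ih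

/-- Any opening costs at most the sum of all costs, so `k` openings cost at most `k` times
that sum. -/
theorem abs_run_le (A : Policy n) (c v : Fin n → ℝ) (k : ℕ) (h : List (Fin n)) :
    |A.run c v k h| ≤ ∑ j, |v j| + k * ∑ j, |c j| := by
  have hc : 0 ≤ ∑ j, |c j| := sum_nonneg fun j _ => abs_nonneg _
  have hbest : ∀ l, |best l v| ≤ ∑ j, |v j| := fun l => by
    rw [abs_of_nonneg (best_nonneg l v)]
    exact best_le_sum l v
  induction k generalizing h with
  | zero => simpa [Policy.run] using hbest h
  | succ k ih =>
    have hk : 0 ≤ ((k + 1 : ℕ) : ℝ) * ∑ j, |c j| := by positivity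
    rw [Policy.run]
    cases A.act h v with
    | openBox i =>
      have h1 := ih (i :: h)
      have h2 : |c i| ≤ ∑ j, |c j| :=
        single_le_sum (f := fun j => |c j|) (fun j _ => abs_nonneg _) (mem_univ i)
      have h3 := abs_sub (A.run c v k (i :: h)) (c i)
      push_cast
      linarith
    | takeSealed i =>
      have h2 : |v i| ≤ ∑ j, |v j| :=
        single_le_sum (f := fun j => |v j|) (fun j _ => abs_nonneg _) (mem_univ i)
      simp only
      linarith
    | quit =>
      simp only
      linarith [hbest h]

instance : Countable (Action n) := by
  let f : Action n → Option (Fin n ⊕ Fin n)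
    | .openBox i => some (.inl i)
    | .takeSealed i => some (.inr i)
    | .quit => none
  refine Function.Injective.countable (f := f) ?_
  rintro (_ | _ | _) (_ | _ | _) h <;> simp_all [f]

instance : MeasurableSingletonClass (Action n) := ⟨fun _ => trivial⟩

theorem measurable_run {X : Type*} [MeasurableSpace X] {P : X → Policy n} {f : X → Fin n → ℝ}
    (hf : Measurable f) (hP : ∀ h, Measurable fun x => (P x).act h (f x)) (c : Fin n → ℝ)
    (k : ℕ) (h : List (Fin n)) : Measurable fun x => (P x).run c (f x) k h := by
  induction k generalizing h with
  | zero => exact (measurable_best h).comp hf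
  | succ k ih =>
    let g : Action n × X → ℝ := fun p =>
      match p.1 with
      | Action.openBox i => (P p.2).run c (f p.2) k (i :: h) - c i
      | Action.takeSealed i => f p.2 i
      | Action.quit => best h (f p.2)
    -- There are countably many actions, so each of them can be treated separately.
    have hg : Measurable g := by
      refine measurable_from_prod_countable_right fun a => ?_
      cases a with
      | openBox i => exact (ih (i :: h)).sub_const _
      | takeSealed i => exact (measurable_pi_apply i).comp hf
      | quit => exact (measurable_best h).comp hf
    exact hg.comp ((hP h).prodMk measurable_id)

theorem measurable_merge (h : List (Fin n)) (v : Fin n → ℝ) : Measurable (merge h v) := by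
  refine measurable_pi_lambda _ fun j => ?_
  by_cases hj : j ∈ h
  · simp [merge, hj]
  · simpa [merge, hj] using measurable_pi_apply j

theorem integrable_sum_abs (B : PNOI n) :
    Integrable (fun w : Fin n → ℝ => ∑ j, |w j|) (law B) :=
  integrable_finsetSum _ fun j _ =>
    (integrable_comp_eval (f := fun x => x) (B.integrable j)).abs

/-- The histories `h`, whose values are given, and `h'`, from which the policy is run, differ when
`h'` includes a box that is being opened. -/
theorem integrable_run_merge (A : Policy n) (B : PNOI n) (k : ℕ) (h h' : List (Fin n))
    (v : Fin n → ℝ) : Integrable (fun w => A.run B.cost (merge h v w) k h') (law B) := by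
  have hm := measurable_merge h v
  refine Integrable.mono' (((integrable_const (∑ j, |v j|)).add (integrable_sum_abs B)).add
    (integrable_const (k * ∑ j, |B.cost j|)))
    (measurable_run (P := fun _ => A) hm (fun l => (A.measurable_act l).comp hm) B.cost k
      h').aestronglyMeasurable (Filter.Eventually.of_forall fun w => ?_)
  refine (abs_run_le A B.cost (merge h v w) k h').trans ?_
  simp only [Pi.add_apply]
  gcongr
  rw [← sum_add_distrib]
  refine sum_le_sum fun j _ => ?_
  have h1 := abs_nonneg (v j)
  have h2 := abs_nonneg (w j)
  by_cases hj : j ∈ h <;> simp [merge, hj]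

/-- The expected payoff that the policy `A` collects from the history `h` on, given the values
`v` of the boxes of `h`, when at most `k` more boxes can be opened. -/
noncomputable def contValue (A : Policy n) (B : PNOI n) (k : ℕ) (h : List (Fin n))
    (v : Fin n → ℝ) : ℝ :=
  ∫ w, A.run B.cost (merge h v w) k h ∂(law B)

theorem best_merge (h : List (Fin n)) (v w : Fin n → ℝ) : best h (merge h v w) = best h v :=
  best_congr fun j hj => by simp [merge, hj]

theorem act_merge (A : Policy n) (h : List (Fin n)) (v w : Fin n → ℝ) :
    A.act h (merge h v w) = A.act h v :=
  A.nonanticipating h _ _ fun j hj => by simp [merge, hj]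

theorem contValue_zero (A : Policy n) (B : PNOI n) (h : List (Fin n)) (v : Fin n → ℝ) :
    contValue A B 0 h v = best h v := by
  simp [contValue, Policy.run, best_merge]

theorem contValue_quit {A : Policy n} {h : List (Fin n)} {v : Fin n → ℝ} (B : PNOI n) (k : ℕ)
    (ha : A.act h v = Action.quit) : contValue A B (k + 1) h v = best h v := by
  simp [contValue, Policy.run, act_merge, ha, best_merge]

theorem contValue_takeSealed {A : Policy n} {h : List (Fin n)} {v : Fin n → ℝ} {i : Fin n}
    (B : PNOI n) (k : ℕ) (ha : A.act h v = Action.takeSealed i) :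
    contValue A B (k + 1) h v = ∫ x, x ∂(B.dist i) := by
  have hi := A.take_sealed h v i ha
  simp only [contValue, Policy.run, act_merge, ha, merge, hi, if_false]
  exact integral_comp_eval (μ := B.dist) (i := i) (f := fun x => x)
    (B.integrable i).aestronglyMeasurable

theorem integrable_contValue_update (A : Policy n) (B : PNOI n) (k : ℕ) {h : List (Fin n)}
    {i : Fin n} (hi : i ∉ h) (v : Fin n → ℝ) :
    Integrable (fun x => contValue A B k (i :: h) (Function.update v i x)) (B.dist i) := by
  simpa only [contValue, merge_update hi] using
    (integrable_update (integrable_run_merge A B k h (i :: h) v) i).integral_prod_left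

theorem contValue_openBox {A : Policy n} {h : List (Fin n)} {v : Fin n → ℝ} {i : Fin n}
    (B : PNOI n) (k : ℕ) (ha : A.act h v = Action.openBox i) :
    contValue A B (k + 1) h v
      = ∫ x, contValue A B k (i :: h) (Function.update v i x) ∂(B.dist i) - B.cost i := by
  have hi := A.open_sealed h v i ha
  have hint := integrable_run_merge A B k h (i :: h) v
  simp only [contValue, Policy.run, act_merge, ha]
  -- The value of `i` is averaged out last.
  rw [integral_sub hint (integrable_const _), integral_resample hint i]
  simp [merge_update hi]

/-- No policy does better than `stateValue`. -/
theorem contValue_le {B : PNOI n} {τ : Fin n → EReal} (hτ : ∀ i, IsIndex B i (τ i))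
    (A : Policy n) (k : ℕ) (h : List (Fin n)) (v : Fin n → ℝ) :
    contValue A B k h v ≤ stateValue B τ (sealedBoxes h) (best h v) := by
  induction k generalizing h v with
  | zero =>
    rw [contValue_zero]
    exact le_stateValue hτ _ _
  | succ k ih =>
    cases ha : A.act h v with
    | openBox i =>
      have hi := A.open_sealed h v i ha
      rw [contValue_openBox B k ha]
      refine le_trans (sub_le_sub_right ?_ _)
        (stateValue_ge_open hτ (mem_sealedBoxes.2 hi) (best_nonneg h v))
      refine integral_mono (integrable_contValue_update A B k hi v)
        (integrable_stateValue_max hτ _ i _) fun x => ?_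
      simpa only [sealedBoxes_cons, best_cons_update hi] using ih (i :: h) (Function.update v i x)
    | takeSealed i =>
      rw [contValue_takeSealed B k ha]
      exact (mean_le_startValue τ (mem_sealedBoxes.2 (A.take_sealed h v i ha))).trans
        (le_max_right _ _)
    | quit =>
      rw [contValue_quit B k ha]
      exact le_stateValue hτ _ _

theorem expPayoff_eq_contValue (A : Policy n) (B : PNOI n) (v : Fin n → ℝ) :
    A.expPayoff B = contValue A B n [] v := by
  simp [Policy.expPayoff, Policy.payoff, contValue, merge_nil]

theorem stateValue_univ_zero (B : PNOI n) (τ : Fin n → EReal) :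
    stateValue B τ univ 0 = startValue B τ univ :=
  max_eq_right (indexValue_le_startValue B τ univ)

theorem expPayoff_le {B : PNOI n} {τ : Fin n → EReal} (hτ : ∀ i, IsIndex B i (τ i))
    (A : Policy n) : A.expPayoff B ≤ startValue B τ univ := by
  rw [expPayoff_eq_contValue A B 0, ← stateValue_univ_zero]
  simpa [sealedBoxes, best] using contValue_le hτ A n [] 0

theorem RandPolicy.expPayoff_le {Ω : Type*} [MeasurableSpace Ω] {B : PNOI n}
    {τ : Fin n → EReal} (hτ : ∀ i, IsIndex B i (τ i)) (R : RandPolicy n Ω) (μ : Measure Ω)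
    [IsProbabilityMeasure μ] : R.expPayoff μ B ≤ startValue B τ univ := by
  have hint : Integrable (fun p : Ω × (Fin n → ℝ) => (R.policy p.1).payoff B p.2)
      (μ.prod (law B)) := by
    refine Integrable.mono' (((integrable_sum_abs B).comp_snd μ).add
      (integrable_const (n * ∑ j, |B.cost j|)))
      (measurable_run measurable_snd R.measurable_act B.cost n []).aestronglyMeasurable
      (Filter.Eventually.of_forall fun p => abs_run_le _ B.cost p.2 n [])
  rw [RandPolicy.expPayoff, integral_prod _ hint]
  have h := integral_mono hint.integral_prod_left (integrable_const (startValue B τ univ))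
    fun ω => Pandora.expPayoff_le hτ (R.policy ω)
  simpa using h

/-! ### The value of the policy described by a list -/

section Described

variable {B : PNOI n} {τ : Fin n → EReal} {σ : List (Fin n)} {V : Fin n → ℝ} {A : Policy n}

theorem Switched.cons_update {h : List (Fin n)} {v : Fin n → ℝ} {i : Fin n}
    (hs : Switched σ V h v) (hi : i ∉ h) (x : ℝ) :
    Switched σ V (i :: h) (Function.update v i x) := by
  rcases hs with hs | ⟨j, hj, hjσ, hjV⟩
  · exact Or.inl hs
  · refine Or.inr ⟨j, List.mem_cons_of_mem _ hj, hjσ, ?_⟩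
    rwa [Function.update_of_ne (ne_of_mem_of_not_mem hj hi)]

/-- Weitzman's theorem: after the switch, the policy attains `indexValue`, however ties are broken. -/
theorem contValue_ge_indexValue (hτ : ∀ i, IsIndex B i (τ i)) (hA : A.DescribedBy τ σ V)
    (k : ℕ) (h : List (Fin n)) (v : Fin n → ℝ) (hs : Switched σ V h v)
    (hk : (sealedBoxes h).card ≤ k) :
    indexValue B τ (sealedBoxes h) (best h v) ≤ contValue A B k h v := by
  induction k generalizing h v with
  | zero =>
    rw [card_eq_zero.1 (Nat.le_zero.1 hk), indexValue_empty, contValue_zero]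
  | succ k ih =>
    have hact := (hA h v).1 hs
    cases ha : A.act h v with
    | openBox i =>
      rw [ha] at hact
      obtain ⟨hi, -, hbest, hmax⟩ := hact
      have hi' := mem_sealedBoxes.2 hi
      rw [contValue_openBox B k ha,
        indexValue_eq_open hτ hi' hbest fun j hj => hmax j (mem_sealedBoxes.1 hj)]
      refine sub_le_sub_right (integral_mono (integrable_indexValue_max hτ _ i _)
        (integrable_contValue_update A B k hi v) fun x => ?_) _
      have := ih (i :: h) (Function.update v i x) (hs.cons_update hi x) (by
        rw [sealedBoxes_cons, card_erase_of_mem hi']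
        omega)
      simpa only [sealedBoxes_cons, best_cons_update hi] using this
    | takeSealed i =>
      rw [ha] at hact
      exact hact.elim
    | quit =>
      rw [ha] at hact
      rw [contValue_quit B k ha,
        indexValue_eq_of_le hτ fun j hj => hact j (mem_sealedBoxes.1 hj)]

theorem filter_notMem_eq {pre ρ h : List (Fin n)} (hnodup : (pre ++ ρ).Nodup)
    (hmem : ∀ j, j ∈ h ↔ j ∈ pre) : (pre ++ ρ).filter (fun j => j ∉ h) = ρ := by
  have hdisj := List.disjoint_of_nodup_append hnodup
  rw [List.filter_append, List.filter_eq_nil_iff.2 fun j hj => by simpa [hmem] using hj,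
    List.filter_eq_self.2 fun j hj => by simpa [hmem] using fun hj' => hdisj hj' hj,
    List.nil_append]

/-- Before the switch, the policy attains `startValue`, whatever the best value seen so far.
Here `ρ` is the list of the boxes of `σ` that are still sealed. -/
theorem contValue_ge_startValue {τ' : Fin n → EReal} (hτ : ∀ i, IsIndex B i (τ i))
    (hτ' : ∀ i, IsIndex B i (τ' i)) (hA : A.DescribedBy τ' σ V) (hσ : σ.Nodup)
    {S : Finset (Fin n)} {ρ : List (Fin n)} (hρ : CommitPlan B τ V S ρ) (pre : List (Fin n))
    (hpre : σ = pre ++ ρ) (k : ℕ) (h : List (Fin n)) (v : Fin n → ℝ)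
    (hmem : ∀ j, j ∈ h ↔ j ∈ pre) (hS : sealedBoxes h = S) (hk : S.card ≤ k)
    (hs : ¬ Switched σ V h v) (hlt : indexValue B τ S (best h v) < startValue B τ S) :
    startValue B τ S ≤ contValue A B k h v := by
  induction hρ generalizing pre k h v with
  | @last S i mem take =>
    obtain ⟨k, rfl⟩ := Nat.exists_eq_add_one_of_ne_zero
      ((card_pos.2 ⟨i, mem⟩).trans_le hk).ne'
    have hact := (hA h v).2 hs
    rw [IsListAction, hpre, filter_notMem_eq (hpre ▸ hσ) hmem] at hact
    rw [contValue_takeSealed B k hact]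
    exact take
  | @cons S i ρ mem opn thr tail ih =>
    obtain ⟨k, rfl⟩ := Nat.exists_eq_add_one_of_ne_zero
      ((card_pos.2 ⟨i, mem⟩).trans_le hk).ne'
    obtain ⟨j, ρ, rfl⟩ := List.exists_cons_of_ne_nil tail.ne_nil
    have hact := (hA h v).2 hs
    rw [IsListAction, hpre, filter_notMem_eq (hpre ▸ hσ) hmem] at hact
    have hi : i ∉ h := A.open_sealed h v i hact
    have hmono := indexValue_mono hτ (S.erase i)
    have hy := best_nonneg h v
    have hS' : sealedBoxes (i :: h) = S.erase i := by rw [sealedBoxes_cons, hS]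
    have hk' : (S.erase i).card ≤ k := by
      rw [card_erase_of_mem mem]
      omega
    have hdrop : i ∈ σ.dropLast := by simp [hpre]
    rw [contValue_openBox B k hact]
    refine opn.trans (sub_le_sub_right (integral_mono (integrable_stateValue_max hτ _ i 0)
      (integrable_contValue_update A B k hi v) fun x => ?_) _)
    have h0 : indexValue B τ (S.erase i) (max x 0)
        ≤ indexValue B τ (S.erase i) (max x (best h v)) := hmono (max_le_max le_rfl hy)
    rcases le_or_gt (V i) x with hx | hx
    · -- The threshold is met, and the index-based policy takes over.
      have hsw : Switched σ V (i :: h) (Function.update v i x) :=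
        Or.inr ⟨i, List.mem_cons_self, hdrop, by simpa using hx⟩
      have h1 := contValue_ge_indexValue hτ' hA k _ _ hsw (by rwa [hS'])
      rw [hS', best_cons_update hi] at h1
      have h2 := (indexValue_le_indexValue hτ hτ' (S.erase i) (max x (best h v))).trans h1
      exact max_le (h0.trans h2) ((((thr x).1 hx).trans (hmono (le_max_left _ _))).trans h2)
    · -- Below the threshold, the index-based policy is still suboptimal, and the list goes on.
      have hns : ¬ Switched σ V (i :: h) (Function.update v i x) := by
        rintro (hnil | ⟨l, hl, hlσ, hlV⟩)
        · exact hs (Or.inl hnil)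
        · by_cases hli : l = i
          · subst hli
            exact hx.not_ge (by simpa using hlV)
          · rw [Function.update_of_ne hli] at hlV
            exact hs (Or.inr ⟨l, (List.mem_cons.1 hl).resolve_left hli, hlσ, hlV⟩)
      have hlow : indexValue B τ (S.erase i) (max x (best h v)) < startValue B τ (S.erase i) := by
        rw [hmono.map_max]
        exact max_lt (not_le.1 fun hle => hx.not_ge ((thr x).2 hle))
          (indexValue_lt_startValue_erase hτ mem opn hy hlt)
      have h1 := ih (pre ++ [i]) (by simp [hpre]) k (i :: h) (Function.update v i x)
        (fun l => by simp [hmem, or_comm]) hS' hk' hns (by rwa [best_cons_update hi])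
      exact max_le ((h0.trans hlow.le).trans h1) h1

end Described

/-! ### Existence of the policy described by a list -/

/-- For each history there is one action that the index-based policy can take whenever it may not
quit. That it does not depend on the values gives measurability in `describedPolicy`. -/
theorem exists_isIndexAction (τ : Fin n → EReal) (h : List (Fin n)) :
    ∃ a : Action n, ∀ v, ¬ (∀ j, j ∉ h → τ j ≤ (best h v : EReal)) →
      IsIndexAction τ h v a := by
  by_cases hne : (sealedBoxes h).Nonempty
  · obtain ⟨i, hi, hmax⟩ := (sealedBoxes h).exists_max_image τ hne
    refine ⟨Action.openBox i, fun v hv => ?_⟩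
    push Not at hv
    obtain ⟨j, hj, hjv⟩ := hv
    have hlt : (best h v : EReal) < τ i := hjv.trans_le (hmax j (mem_sealedBoxes.2 hj))
    have h0 : (0 : EReal) ≤ best h v := by exact_mod_cast best_nonneg h v
    exact ⟨mem_sealedBoxes.1 hi, h0.trans_lt hlt, hlt.le,
      fun l hl => hmax l (mem_sealedBoxes.2 hl)⟩
  · refine ⟨Action.quit, fun v hv => (hv fun j hj => ?_).elim⟩
    exact absurd ⟨j, mem_sealedBoxes.2 hj⟩ hne

/-- The action prescribed by the list `σ` before the switch. -/
def listAction (σ h : List (Fin n)) : Action n :=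
  match σ.filter (fun i => i ∉ h) with
  | [] => Action.quit
  | [i] => Action.takeSealed i
  | i :: _ :: _ => Action.openBox i

theorem isListAction_listAction (σ h : List (Fin n)) : IsListAction σ h (listAction σ h) := by
  unfold IsListAction listAction
  split <;> simp_all

theorem listAction_sealed {σ h : List (Fin n)} {i : Fin n}
    (hi : listAction σ h = Action.openBox i ∨ listAction σ h = Action.takeSealed i) : i ∉ h := by
  have key : i ∈ σ.filter (fun i => i ∉ h) := by
    unfold listAction at hi
    split at hi <;> simp_all
  simpa using (List.mem_filter.1 key).2

theorem switched_congr {σ : List (Fin n)} {V : Fin n → ℝ} {h : List (Fin n)} {v w : Fin n → ℝ}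
    (hvw : ∀ i ∈ h, v i = w i) : Switched σ V h v ↔ Switched σ V h w := by
  refine or_congr_right (exists_congr fun i => and_congr_right fun hi => ?_)
  rw [hvw i hi]

theorem measurableSet_switched (σ : List (Fin n)) (V : Fin n → ℝ) (h : List (Fin n)) :
    MeasurableSet {v | Switched σ V h v} := by
  have : {v | Switched σ V h v}
      = {_v | σ = []} ∪ ⋃ i : Fin n, {_v | i ∈ h ∧ i ∈ σ.dropLast} ∩ {v | V i ≤ v i} := by
    ext v
    simp [Switched, and_assoc]
  rw [this]
  exact (MeasurableSet.const _).union (MeasurableSet.iUnion fun i =>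
    (MeasurableSet.const _).inter (measurableSet_le measurable_const (measurable_pi_apply i)))

open Classical in
/-- The policy described by `σ` and `V`, ties in the index-based policy being broken in favour of
quitting, and then by a choice of a sealed box for each history. -/
noncomputable def describedPolicy (τ : Fin n → EReal) (σ : List (Fin n)) (V : Fin n → ℝ) :
    Policy n where
  act h v :=
    if Switched σ V h v then
      if ∀ j, j ∉ h → τ j ≤ (best h v : EReal) then Action.quit
      else (exists_isIndexAction τ h).choose
    else listAction σ h
  measurable_act h := by
    refine Measurable.ite (measurableSet_switched σ V h)
      (Measurable.ite ?_ measurable_const measurable_const) measurable_const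
    simp only [Set.ofPred_forall]
    exact MeasurableSet.iInter fun j => MeasurableSet.iInter fun _ =>
      measurableSet_le measurable_const (measurable_coe_real_ereal.comp (measurable_best h))
  nonanticipating h v w hvw := by
    simp only [switched_congr hvw, best_congr hvw]
  open_sealed h v i ha := by
    split_ifs at ha with h1 h2
    · have := (exists_isIndexAction τ h).choose_spec v h2
      rw [ha] at this
      exact this.1
    · exact listAction_sealed (Or.inl ha)
  take_sealed h v i ha := by
    split_ifs at ha with h1 h2
    · have := (exists_isIndexAction τ h).choose_spec v h2
      rw [ha] at this
      exact this.elim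
    · exact listAction_sealed (Or.inr ha)

theorem describedPolicy_describedBy (τ : Fin n → EReal) (σ : List (Fin n)) (V : Fin n → ℝ) :
    (describedPolicy τ σ V).DescribedBy τ σ V := by
  intro h v
  refine ⟨fun hs => ?_, fun hs => ?_⟩
  · simp only [describedPolicy, if_pos hs]
    split_ifs with hq
    · exact hq
    · exact (exists_isIndexAction τ h).choose_spec v hq
  · simp only [describedPolicy, if_neg hs]
    exact isListAction_listAction σ h

/-! ### The structure theorem -/

theorem isOptimal_of_startValue_le {B : PNOI n} {τ : Fin n → EReal}
    (hτ : ∀ i, IsIndex B i (τ i)) {A : Policy n}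
    (h : startValue B τ univ ≤ contValue A B n [] 0) : Policy.IsOptimal.{u} A B := by
  intro Ω _ μ _ R
  rw [expPayoff_eq_contValue A B 0]
  exact (RandPolicy.expPayoff_le hτ R μ).trans h

end Pandora

theorem mainTheorem3 {n : ℕ} (B : PNOI n) :
    ∃ (T : Finset (Fin n)) (σ : List (Fin n)) (V : Fin n → ℝ),
      σ.Nodup ∧ σ.toFinset = T ∧
      ∀ τ : Fin n → EReal, (∀ i, Pandora.IsIndex B i (τ i)) →
        (∃ A : Pandora.Policy n, A.DescribedBy τ σ V) ∧
        ∀ A : Pandora.Policy n, A.DescribedBy τ σ V → Pandora.Policy.IsOptimal.{u} A B := by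
  open Pandora in
  choose τ₀ hτ₀ using exists_isIndex B
  have hsealed : sealedBoxes ([] : List (Fin n)) = Finset.univ := by simp [sealedBoxes]
  have hcard : (Finset.univ : Finset (Fin n)).card ≤ n := by simp
  rcases (indexValue_le_startValue B τ₀ Finset.univ).eq_or_lt with heq | hlt
  · refine ⟨∅, [], 0, List.nodup_nil, rfl, fun τ hτ =>
      ⟨⟨_, describedPolicy_describedBy τ [] 0⟩, fun A hA => isOptimal_of_startValue_le hτ₀ ?_⟩⟩
    have h := contValue_ge_indexValue hτ hA n [] 0 (Or.inl rfl) (by rwa [hsealed])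
    rw [hsealed] at h
    exact heq.ge.trans ((indexValue_le_indexValue hτ₀ hτ _ _).trans h)
  · obtain ⟨V, σ, hσ⟩ := exists_commitPlan hτ₀ Finset.univ hlt
    refine ⟨σ.toFinset, σ, V, hσ.nodup, rfl, fun τ hτ =>
      ⟨⟨_, describedPolicy_describedBy τ σ V⟩, fun A hA => isOptimal_of_startValue_le hτ₀ ?_⟩⟩
    have hs : ¬ Switched σ V [] 0 := by simp [Switched, hσ.ne_nil]
    exact contValue_ge_startValue hτ₀ hτ hA hσ.nodup hσ [] rfl n [] 0 (fun j => Iff.rfl)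
      hsealed hcard hs hlt
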